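/- Let $K$ be a field with $\operatorname{char} K \neq 2$ and let $k \geq 0$ be an integer. Let $E$ be the Grassmann (exterior) algebra of a $K$-vector space of countably infinite dimension and $E_r$ the Grassmann algebra of an $r$-dimensional $K$-vector space. Write $E\otimes E_r^{\otimes k}=E\otimes_K \underbrace{E_r\otimes_K\cdots\otimes_K E_r}_{k}$ for the tensor product of associative $K$-algebras with the usual (ungraded) multiplication; $E_r^{\otimes 0}=K$. Long commutators are left-normed: $[x_1]=x_1$, $[x_1,x_2]=x_1x_2-x_2x_1$ and $[x_1,\dots,x_{p+1}]=[[x_1,\dots,x_p],x_{p+1}]$. A $K$-algebra $A$ satisfies the identity $[x_1,\dots,x_q]=0$ if $[a_1,\dots,a_q]=0$ for all $a_1,\dots,a_q\in A$. 1. If moreover $\operatorname{char} K\neq 3$, then both $E\otimes E_2^{\otimes k}$ and $E\otimes E_3^{\otimes k}$ satisfy the identity $[x_1,\dots,x_{2k+3}]=0$. 2. Neither $E\otimes E_2^{\otimes k}$ nor $E\otimes E_3^{\otimes k}$ satisfies the identity $[x_1,\dots,x_{2k+2}]=0$ (here $\operatorname{char} K\neq 2$ suffices). 3. Consequently, if $\operatorname{char}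 K\neq 2,3$, the minimal integer $q\geq 1$ such that $E\otimes E_2^{\otimes k}$ satisfies $[x_1,\dots,x_q]=0$ is $q=2k+3$. -/

import Mathlib

open scoped TensorProduct

namespace GrassmannPI

universe u v

/-- The left-normed long commutator `[u_1, …, u_n]` of a sequence in a ring, with `[u_1] = u_1` and
`[u_1, …, u_{p+1}] = [[u_1, …, u_p], u_{p+1}]`, where `⁅a, b⁆ = a * b - b * a`.
Sequences are indexed from `0`, so that `u i` stands for `u_{i+1}`.
The value at length `0` is a convention that is never used. -/
def longCommutator {A : Type v} [Ring A] (u : ℕ → A) : ℕ → A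
  | 0 => 0
  | 1 => u 0
  | n + 2 => ⁅longCommutator u (n + 1), u (n + 1)⁆

/-- The polynomial `[x_1, …, x_n]` in the free unital associative algebra on countably many
variables. -/
def lieNilpotentPoly (K : Type u) [Field K] (n : ℕ) : FreeAlgebra K ℕ :=
  longCommutator (FreeAlgebra.ι K) n

/-- The algebra `A` satisfies the polynomial identity `f = 0`: every substitution of elements of `A`
for the variables annihilates `f`. -/
def SatisfiesIdentity (K : Type u) [Field K] (A : Type v) [Ring A] [Algebra K A]
    (f : FreeAlgebra K ℕ) : Prop :=
  ∀ a : ℕ → A, FreeAlgebra.lift K a f = 0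

/-- The Grassmann algebra of a `K`-vector space of countably infinite dimension. -/
abbrev GrassmannInf (K : Type u) [Field K] : Type u :=
  ExteriorAlgebra K (ℕ →₀ K)

/-- The Grassmann algebra of an `r`-dimensional `K`-vector space. -/
abbrev GrassmannFin (K : Type u) [Field K] (r : ℕ) : Type u :=
  ExteriorAlgebra K (Fin r → K)

/-- The algebra `E ⊗ E_r ⊗ ⋯ ⊗ E_r` with `k` factors `E_r`, with the usual (ungraded) multiplication
of tensor products of algebras. -/
abbrev GrassmannTensor (K : Type u) [Field K] (r k : ℕ) : Type u :=
  GrassmannInf K ⊗[K] (⨂[K] _ : Fin k, GrassmannFin K r)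

end GrassmannPI

/-! Upper bound: write `u ∘ v` for `u * v + v * u`. For commuting subalgebras `A`, `B` one has `2[u
b, a b'] = [u, a](b ∘ b') + (u ∘ a)[b, b']`. If the commutators of `B` lie in a central ideal,
further brackets act on the second term only through `A`. Hence commutators in the product are
controlled by commutators in `A` and by Jordan products of commutators in `A`. The crux is
`jordan_eq_zero`: if commutators of length `n + 1` vanish in `A` and `3` is invertible, then Jordan
products of two commutators of total length `n + 3` vanish. So each factor `B` raises the vanishing
length by at most two (`lieSeries_eq_bot_of_span_eq_top`). The induction starts from `[x, y, z] = 0`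
in `E`; `B = E_r` with `r < 4` qualifies since products of four generators are zero there.

Lower bound: an explicit commutator of length `2k + 2` equals `2 ^ (2k + 1)` times a nonzero pure
tensor, because every bracket in it is of two anticommuting elements. -/

open scoped TensorProduct

namespace GrassmannPI

/-! ### Left-normed commutators and the lower central series -/

section LieSeries

variable {A : Type*} [Ring A]

/-- The iterated commutator `[x, y_1, …, y_r]`. -/
def foldBracket (x : A) (ys : List A) : A := ys.foldl (fun u y => ⁅u, y⁆) x

@[simp] theorem foldBracket_nil (x : A) : foldBracket x [] = x := rfl

@[simp] theorem foldBracket_cons (x y : A) (ys : List A) :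
    foldBracket x (y :: ys) = foldBracket ⁅x, y⁆ ys := rfl

theorem foldBracket_concat (x y : A) (ys : List A) :
    foldBracket x (ys ++ [y]) = ⁅foldBracket x ys, y⁆ := by
  simp [foldBracket]

theorem foldBracket_add (x y : A) (ys : List A) :
    foldBracket (x + y) ys = foldBracket x ys + foldBracket y ys := by
  induction ys generalizing x y with
  | nil => rfl
  | cons z ys ih =>
    rw [foldBracket_cons, foldBracket_cons, foldBracket_cons, ← ih]
    congr 1
    simp only [Ring.lie_def]; noncomm_ring

theorem foldBracket_neg (x : A) (ys : List A) :
    foldBracket (-x) ys = -foldBracket x ys := by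
  induction ys generalizing x with
  | nil => rfl
  | cons z ys ih =>
    rw [foldBracket_cons, foldBracket_cons, ← ih]
    congr 1
    simp only [Ring.lie_def]; noncomm_ring

theorem longCommutator_eq_foldBracket (a : ℕ → A) (m : ℕ) :
    ∃ ys : List A, ys.length = m ∧ longCommutator a (m + 1) = foldBracket (a 0) ys := by
  induction m with
  | zero => exact ⟨[], rfl, rfl⟩
  | succ m ih =>
    obtain ⟨ys, hl, h⟩ := ih
    exact ⟨ys ++ [a (m + 1)], by simp [hl], by rw [foldBracket_concat, ← h]; rfl⟩

variable {K : Type*} [Field K] [Algebra K A]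

/-- The span of the left-normed commutators of length `m + 1`. -/
def lieSeries (K A : Type*) [Field K] [Ring A] [Algebra K A] (m : ℕ) : Submodule K A :=
  Submodule.span K {w | ∃ x : A, ∃ ys : List A, ys.length = m ∧ foldBracket x ys = w}

theorem foldBracket_mem_lieSeries (x : A) (ys : List A) :
    foldBracket x ys ∈ lieSeries K A ys.length :=
  Submodule.subset_span ⟨x, ys, rfl, rfl⟩

theorem mem_lieSeries_zero (x : A) : x ∈ lieSeries K A 0 :=
  Submodule.subset_span ⟨x, [], rfl, rfl⟩

theorem lie_mem_lieSeries {m : ℕ} {u : A} (hu : u ∈ lieSeries K A m) (a : A) :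
    ⁅u, a⁆ ∈ lieSeries K A (m + 1) := by
  induction hu using Submodule.span_induction with
  | mem w hw =>
    obtain ⟨x, ys, hl, rfl⟩ := hw
    exact Submodule.subset_span ⟨x, ys ++ [a], by simp [hl], foldBracket_concat _ _ _⟩
  | zero => simp [Ring.lie_def]
  | add u v _ _ hu hv => rw [show ⁅u + v, a⁆ = ⁅u, a⁆ + ⁅v, a⁆ by simp only [Ring.lie_def]; noncomm_ring]; exact add_mem hu hv
  | smul c u _ hu => rw [show ⁅c • u, a⁆ = c • ⁅u, a⁆ by simp [Ring.lie_def, smul_sub]]; exact Submodule.smul_mem _ _ hu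

theorem lieSeries_succ_le {m : ℕ} {N : Submodule K A}
    (h : ∀ u ∈ lieSeries K A m, ∀ a, ⁅u, a⁆ ∈ N) : lieSeries K A (m + 1) ≤ N := by
  refine Submodule.span_le.2 ?_
  rintro _ ⟨x, ys, hl, rfl⟩
  rcases List.eq_nil_or_concat ys with rfl | ⟨zs, z, rfl⟩
  · simp at hl
  · simp only [List.concat_eq_append, List.length_append, List.length_singleton,
      Nat.add_right_cancel_iff] at hl ⊢
    subst hl
    rw [foldBracket_concat]
    exact h _ (foldBracket_mem_lieSeries _ _) _

theorem lieSeries_antitone : Antitone (lieSeries K A) := by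
  refine antitone_nat_of_succ_le fun m => ?_
  induction m with
  | zero => exact fun x _ => mem_lieSeries_zero x
  | succ m ih => exact lieSeries_succ_le fun u hu a => lie_mem_lieSeries (ih hu) a

theorem foldBracket_mem_of_mem {m : ℕ} {u : A} (hu : u ∈ lieSeries K A m) (ys : List A) :
    foldBracket u ys ∈ lieSeries K A (m + ys.length) := by
  induction ys generalizing m u with
  | nil => exact hu
  | cons y ys ih =>
    have := ih (lie_mem_lieSeries hu y)
    rwa [List.length_cons, add_comm ys.length, ← add_assoc]

theorem eq_zero_of_lieSeries_eq_bot {n m : ℕ} (h : lieSeries K A n = ⊥) (hnm : n ≤ m) {u : A}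
    (hu : u ∈ lieSeries K A m) : u = 0 := by
  simpa [h] using lieSeries_antitone hnm hu

theorem lieSeries_eq_bot_of_surjective {R : Type*} [Ring R] [Algebra K R] {f : A →ₐ[K] R}
    (hf : Function.Surjective f) {m : ℕ} (h : lieSeries K A m = ⊥) : lieSeries K R m = ⊥ := by
  have key : ∀ m, lieSeries K R m ≤ (lieSeries K A m).map f.toLinearMap := by
    intro m
    induction m with
    | zero =>
      intro x _
      obtain ⟨y, rfl⟩ := hf x
      exact ⟨y, mem_lieSeries_zero y, rfl⟩
    | succ m ih =>
      refine lieSeries_succ_le fun u hu a => ?_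
      obtain ⟨v, hv, rfl⟩ := ih hu
      obtain ⟨b, rfl⟩ := hf a
      exact ⟨⁅v, b⁆, lie_mem_lieSeries hv b, by simp [Ring.lie_def]⟩
  simpa [h] using key m

/-! ### Jordan products of long commutators -/

/-- If mixed Jordan products with a short right factor vanish, an iterated commutator of a Jordan
product only differentiates the right factor. -/
theorem foldBracket_jordan {n i q : ℕ}
    (hJ : ∀ j < q, ∀ i, n + 1 ≤ i + j → ∀ u ∈ lieSeries K A i, ∀ v ∈ lieSeries K A j,
      u * v + v * u = 0) (ys : List A) {j : ℕ} (hj : j + ys.length ≤ q)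
    (hn : n + 1 ≤ i + j + ys.length) {x y : A} (hx : x ∈ lieSeries K A i)
    (hy : y ∈ lieSeries K A j) :
    foldBracket (x * y + y * x) ys = x * foldBracket y ys + foldBracket y ys * x := by
  induction ys generalizing i j x y with
  | nil => rfl
  | cons z ys ih =>
    simp only [List.length_cons] at hj hn
    have e : ⁅x * y + y * x, z⁆ = (⁅x, z⁆ * y + y * ⁅x, z⁆) + (x * ⁅y, z⁆ + ⁅y, z⁆ * x) := by
      simp only [Ring.lie_def]; noncomm_ring
    rw [foldBracket_cons, e, foldBracket_add, foldBracket_cons,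
      ih (by omega) (by omega) (lie_mem_lieSeries hx z) hy,
      ih (by omega) (by omega) hx (lie_mem_lieSeries hy z),
      hJ _ (by omega) _ (by omega) _ (lie_mem_lieSeries hx z) _ (foldBracket_mem_of_mem hy ys),
      zero_add]

/-- A function of four variables that is antisymmetric in the first three and satisfies the Jacobi
identity in the last three is killed by `3`. -/
theorem three_nsmul_eq_zero_of_antisymm_of_jacobi {X G : Type*} [AddCommGroup G]
    (F : X → X → X → X → G) (h12 : ∀ a b y z, F a b y z + F b a y z = 0)
    (h23 : ∀ a b y z, F a b y z + F a y b z = 0)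
    (hJ : ∀ a b y z, F a b y z + F a y z b + F a z b y = 0) (a b y z : X) :
    3 • F a b y z = 0 := by
  have e12 := fun a b y z => eq_neg_of_add_eq_zero_left (h12 a b y z)
  have e23 := fun a b y z => eq_neg_of_add_eq_zero_left (h23 a b y z)
  have ja := hJ a b y z
  have jb := hJ b a y z
  have jz := hJ z a b y
  have jy := hJ y a b z
  -- Up to sign only four values remain, indexed by the variable in the last slot. With `P = F a b y
  -- z` and `R = F a b z y`, the four Jacobi relations yield `R = 2P` and `P = 2R`, so `3P = 0`.
  rw [e23 a z b y] at ja
  rw [e12 b a y z, e23 b z a y, e12 b a z y, neg_neg] at jb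
  rw [e12 y a b z, e23 a y b z, neg_neg, e12 y b z a, e23 y z a b, e12 y a z b, neg_neg] at jy
  rw [e12 z a b y, e23 a z b y, neg_neg, e12 z b y a, e23 b z y a, neg_neg, e12 z y a b,
    e23 y z a b, e12 y a z b, neg_neg] at jz
  clear h12 h23 hJ e12 e23
  grind

/-- Bracketing `[c, a ∘ b] = [c, a] ∘ b + [c, b] ∘ a` with `ys` gives zero on the left by
nilpotency. On the right, `foldBracket_jordan` moves all the brackets onto `b` and `a`. -/
theorem foldBracket_jordan_skew {n i j : ℕ} (h : lieSeries K A n = ⊥) (hn : n ≤ i + j)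
    (hJ : ∀ j' < j, ∀ i, n + 1 ≤ i + j' → ∀ u ∈ lieSeries K A i, ∀ v ∈ lieSeries K A j',
      u * v + v * u = 0) {c : A} (hc : c ∈ lieSeries K A i) (a b : A) (ys : List A)
    (hys : ys.length = j) :
    (⁅c, a⁆ * foldBracket b ys + foldBracket b ys * ⁅c, a⁆) +
      (⁅c, b⁆ * foldBracket a ys + foldBracket a ys * ⁅c, b⁆) = 0 := by
  have e : ⁅c, a * b + b * a⁆ = (⁅c, a⁆ * b + b * ⁅c, a⁆) + (⁅c, b⁆ * a + a * ⁅c, b⁆) := by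
    simp only [Ring.lie_def]; noncomm_ring
  rw [← foldBracket_jordan hJ ys (by omega) (by omega) (lie_mem_lieSeries hc a)
      (mem_lieSeries_zero b),
    ← foldBracket_jordan hJ ys (by omega) (by omega) (lie_mem_lieSeries hc b)
      (mem_lieSeries_zero a), ← foldBracket_add, ← e]
  exact eq_zero_of_lieSeries_eq_bot h (by omega)
    (foldBracket_mem_of_mem (lie_mem_lieSeries hc _) ys)

/-- In a Lie nilpotent algebra of characteristic different from `3`, Jordan products of long
commutators of total length exceeding the nilpotency class by two vanish. -/
theorem jordan_eq_zero {n : ℕ} (h3 : (3 : K) ≠ 0) (h : lieSeries K A n = ⊥) (j i : ℕ)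
    (hij : n + 1 ≤ i + j) (u : A) (hu : u ∈ lieSeries K A i) (v : A) (hv : v ∈ lieSeries K A j) :
    u * v + v * u = 0 := by
  induction j using Nat.strong_induction_on generalizing i u v with
  | _ j ih =>
  have hJ : ∀ j' < j, ∀ i, n + 1 ≤ i + j' → ∀ u ∈ lieSeries K A i, ∀ v ∈ lieSeries K A j',
      u * v + v * u = 0 := fun j' hj' i hi u hu v hv => ih j' hj' i hi u hu v hv
  by_cases hi : n ≤ i
  · simp [eq_zero_of_lieSeries_eq_bot h hi hu]
  by_cases hj : n ≤ j
  · simp [eq_zero_of_lieSeries_eq_bot h hj hv]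
  -- Both indices are below `n` with sum at least `n + 1`, hence at least two. So `u` may be taken
  -- as `[c, a]` and `v` as `[b, y, z, …]`, which supplies the four variables `a, b, y, z`.
  obtain ⟨i, rfl⟩ : ∃ i', i = i' + 1 := ⟨i - 1, by omega⟩
  obtain ⟨r, rfl⟩ : ∃ r, j = r + 2 := ⟨j - 2, by omega⟩
  suffices hmain : ∀ c ∈ lieSeries K A i, ∀ a b : A, ∀ ys : List A, ys.length = r + 2 →
      ⁅c, a⁆ * foldBracket b ys + foldBracket b ys * ⁅c, a⁆ = 0 by
    induction hv using Submodule.span_induction with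
    | mem w hw =>
      obtain ⟨b, ys, hl, rfl⟩ := hw
      let N : Submodule K A := LinearMap.ker (LinearMap.mulRight K (foldBracket b ys) +
        LinearMap.mulLeft K (foldBracket b ys))
      have hN : lieSeries K A (i + 1) ≤ N := lieSeries_succ_le fun c hc a => by
        simpa [N] using hmain c hc a b ys hl
      simpa [N] using hN hu
    | zero => simp
    | add v w _ _ hv hw =>
      rw [show u * (v + w) + (v + w) * u = (u * v + v * u) + (u * w + w * u) by noncomm_ring, hv,
        hw, add_zero]
    | smul s v _ hv => rw [mul_smul_comm, smul_mul_assoc, ← smul_add, hv, smul_zero]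
  rintro c hc a b (_ | ⟨y, _ | ⟨z, ys⟩⟩) hl
  · simp at hl
  · simp at hl
  have key := three_nsmul_eq_zero_of_antisymm_of_jacobi
    (fun a b y z => ⁅c, a⁆ * foldBracket b (y :: z :: ys) + foldBracket b (y :: z :: ys) * ⁅c, a⁆)
    (fun a b y z => foldBracket_jordan_skew h (by omega) hJ hc a b _ (by simpa using hl))
    (fun a b y z => by
      have e : ⁅b, y⁆ = -⁅y, b⁆ := by simp [Ring.lie_def]
      have e' : ⁅-⁅y, b⁆, z⁆ = -⁅⁅y, b⁆, z⁆ := by simp only [Ring.lie_def]; noncomm_ring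
      simp only [foldBracket_cons]
      rw [e, e', foldBracket_neg]
      noncomm_ring)
    (fun a b y z => by
      have e : ⁅⁅b, y⁆, z⁆ = -(⁅⁅y, z⁆, b⁆ + ⁅⁅z, b⁆, y⁆) := by
        simp only [Ring.lie_def]; noncomm_ring
      simp only [foldBracket_cons]
      rw [e, foldBracket_neg, foldBracket_add]
      noncomm_ring) a b y z
  rw [← Nat.cast_smul_eq_nsmul K] at key
  exact (smul_eq_zero.1 key).resolve_left (by exact_mod_cast h3)

end LieSeries
end GrassmannPI

namespace GrassmannPI

/-! ### Adjoining one commuting factor -/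

section Step

variable {K A : Type*} [Field K] [Ring A] [Algebra K A]

/-- The span of the Jordan products of commutators of total length `m + 1`. -/
def jordanSpan (K A : Type*) [Field K] [Ring A] [Algebra K A] (m : ℕ) : Submodule K A :=
  Submodule.span K {w | ∃ i j, i + j + 1 = m ∧ ∃ u ∈ lieSeries K A i, ∃ v ∈ lieSeries K A j,
    u * v + v * u = w}

theorem lie_mem_jordanSpan {m : ℕ} {d : A} (hd : d ∈ jordanSpan K A m) (a : A) :
    ⁅d, a⁆ ∈ jordanSpan K A (m + 1) := by
  induction hd using Submodule.span_induction with
  | mem w hw =>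
    obtain ⟨i, j, hij, u, hu, v, hv, rfl⟩ := hw
    have e : ⁅u * v + v * u, a⁆ = (⁅u, a⁆ * v + v * ⁅u, a⁆) + (u * ⁅v, a⁆ + ⁅v, a⁆ * u) := by
      simp only [Ring.lie_def]; noncomm_ring
    rw [e]
    exact add_mem
      (Submodule.subset_span ⟨i + 1, j, by omega, _, lie_mem_lieSeries hu a, _, hv, rfl⟩)
      (Submodule.subset_span ⟨i, j + 1, by omega, _, hu, _, lie_mem_lieSeries hv a, rfl⟩)
  | zero => simp [Ring.lie_def]
  | add u v _ _ hu hv =>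
    rw [show ⁅u + v, a⁆ = ⁅u, a⁆ + ⁅v, a⁆ by simp only [Ring.lie_def]; noncomm_ring]
    exact add_mem hu hv
  | smul c u _ hu =>
    rw [show ⁅c • u, a⁆ = c • ⁅u, a⁆ by simp [Ring.lie_def, smul_sub]]
    exact Submodule.smul_mem _ _ hu

theorem jordanSpan_eq_bot {n : ℕ} (h3 : (3 : K) ≠ 0) (h : lieSeries K A n = ⊥) :
    jordanSpan K A (n + 2) = ⊥ := by
  refine (Submodule.eq_bot_iff _).2 fun w hw => ?_
  refine (Submodule.span_le (p := ⊥)).2 ?_ hw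
  rintro _ ⟨i, j, hij, u, hu, v, hv, rfl⟩
  exact jordan_eq_zero h3 h j i (by omega) u hu v hv

variable {B R : Type*} [Ring B] [Algebra K B] [Ring R] [Algebra K R]

/-- The first summand leaks into the second through the term `(u ∘ a)[b, b']`. The second is stable:
since `z` is central, `[d z, a b'] = [d, a] (z b')`, and `[d, a]` is again a sum of Jordan products
by the Leibniz rule. -/
theorem lieSeries_le_of_span_eq_top (h2 : (2 : K) ≠ 0) (f : A →ₐ[K] R) (g : B →ₐ[K] R)
    (hfg : ∀ a b, Commute (f a) (g b))
    (hspan : Submodule.span K {w | ∃ a b, f a * g b = w} = ⊤) (Z : Submodule K B)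
    (hZ : ∀ b b' : B, ⁅b, b'⁆ ∈ Z) (hmul : ∀ z ∈ Z, ∀ b, z * b ∈ Z)
    (hcomm : ∀ z ∈ Z, ∀ b, Commute z b) (m : ℕ) :
    lieSeries K R m ≤ Submodule.span K {w | ∃ u ∈ lieSeries K A m, ∃ b, f u * g b = w} ⊔
      Submodule.span K {w | ∃ d ∈ jordanSpan K A m, ∃ z ∈ Z, f d * g z = w} := by
  induction m with
  | zero =>
    refine le_trans (le_of_le_of_eq le_top hspan.symm) (le_trans (Submodule.span_mono ?_) le_sup_left)
    rintro _ ⟨a, b, rfl⟩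
    exact ⟨a, mem_lieSeries_zero a, b, rfl⟩
  | succ m ih =>
    set N := Submodule.span K {w | ∃ u ∈ lieSeries K A (m + 1), ∃ b, f u * g b = w} ⊔
      Submodule.span K {w | ∃ d ∈ jordanSpan K A (m + 1), ∃ z ∈ Z, f d * g z = w} with hN
    have prod : ∀ a b a' b', f a * g b * (f a' * g b') = f (a * a') * g (b * b') := by
      intro a b a' b'
      rw [mul_assoc, ← mul_assoc (g b), ← (hfg a' b).eq, mul_assoc, ← mul_assoc (f a), map_mul,
        map_mul]
    refine lieSeries_succ_le fun w hw r => ?_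
    have hr : r ∈ Submodule.span K {w | ∃ a b, f a * g b = w} := hspan ▸ Submodule.mem_top
    suffices hgen : ∀ a b, ∀ w ∈ Submodule.span K {w | ∃ u ∈ lieSeries K A m, ∃ b, f u * g b = w} ⊔
      Submodule.span K {w | ∃ d ∈ jordanSpan K A m, ∃ z ∈ Z, f d * g z = w},
        ⁅w, f a * g b⁆ ∈ N by
      have hw' := ih hw
      let φ : R →ₗ[K] R := LinearMap.mulLeft K w - LinearMap.mulRight K w
      have : Submodule.span K {w | ∃ a b, f a * g b = w} ≤ N.comap φ := by
        refine Submodule.span_le.2 ?_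
        rintro _ ⟨a, b, rfl⟩
        exact hgen a b w hw'
      exact this hr
    intro a b' w hw
    let φ : R →ₗ[K] R := LinearMap.mulRight K (f a * g b') - LinearMap.mulLeft K (f a * g b')
    suffices hle : Submodule.span K {w | ∃ u ∈ lieSeries K A m, ∃ b, f u * g b = w} ⊔
      Submodule.span K {w | ∃ d ∈ jordanSpan K A m, ∃ z ∈ Z, f d * g z = w} ≤ N.comap φ from
      hle hw
    refine sup_le (Submodule.span_le.2 ?_) (Submodule.span_le.2 ?_)
    · rintro _ ⟨u, hu, b, rfl⟩
      have e : φ (f u * g b) = (2 : K)⁻¹ • (f ⁅u, a⁆ * g (b * b' + b' * b)) +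
          (2 : K)⁻¹ • (f (u * a + a * u) * g ⁅b, b'⁆) := by
        have : (2 : K) • φ (f u * g b) = f ⁅u, a⁆ * g (b * b' + b' * b) +
            f (u * a + a * u) * g ⁅b, b'⁆ := by
          change (2 : K) • (f u * g b * (f a * g b') - f a * g b' * (f u * g b)) = _
          rw [prod, prod]
          simp only [Ring.lie_def, map_sub, map_add, two_smul]
          noncomm_ring
        rw [← smul_add, ← this, smul_smul, inv_mul_cancel₀ h2, one_smul]
      rw [SetLike.mem_coe, Submodule.mem_comap, e]
      exact add_mem
        (N.smul_mem _ (Submodule.mem_sup_left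
          (Submodule.subset_span ⟨_, lie_mem_lieSeries hu a, _, rfl⟩)))
        (N.smul_mem _ (Submodule.mem_sup_right (Submodule.subset_span
          ⟨_, Submodule.subset_span ⟨m, 0, rfl, _, hu, _, mem_lieSeries_zero a, rfl⟩, _,
            hZ b b', rfl⟩)))
    · rintro _ ⟨d, hd, z, hz, rfl⟩
      have e : φ (f d * g z) = f ⁅d, a⁆ * g (z * b') := by
        change f d * g z * (f a * g b') - f a * g b' * (f d * g z) = _
        rw [prod, prod, ← (hcomm z hz b').eq, Ring.lie_def, map_sub, sub_mul]
      rw [SetLike.mem_coe, Submodule.mem_comap, e]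
      exact Submodule.mem_sup_right (Submodule.subset_span
        ⟨_, lie_mem_jordanSpan hd a, _, hmul z hz b', rfl⟩)

theorem lieSeries_eq_bot_of_span_eq_top (h2 : (2 : K) ≠ 0) (h3 : (3 : K) ≠ 0) (f : A →ₐ[K] R)
    (g : B →ₐ[K] R) (hfg : ∀ a b, Commute (f a) (g b))
    (hspan : Submodule.span K {w | ∃ a b, f a * g b = w} = ⊤) (Z : Submodule K B)
    (hZ : ∀ b b' : B, ⁅b, b'⁆ ∈ Z) (hmul : ∀ z ∈ Z, ∀ b, z * b ∈ Z)
    (hcomm : ∀ z ∈ Z, ∀ b, Commute z b) {n : ℕ} (h : lieSeries K A n = ⊥) :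
    lieSeries K R (n + 2) = ⊥ := by
  refine eq_bot_iff.2
    ((lieSeries_le_of_span_eq_top h2 f g hfg hspan Z hZ hmul hcomm (n + 2)).trans ?_)
  rw [jordanSpan_eq_bot h3 h, eq_bot_iff.2 ((lieSeries_antitone (Nat.le_add_right n 2)).trans h.le)]
  refine sup_le (Submodule.span_le.2 ?_) (Submodule.span_le.2 ?_)
  · rintro _ ⟨u, hu, b, rfl⟩
    simp [(Submodule.mem_bot K).1 hu]
  · rintro _ ⟨d, hd, z, _, rfl⟩
    simp [(Submodule.mem_bot K).1 hd]

end Step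

/-! ### Centrality and commutators in Grassmann algebras -/

section Grassmann

open ExteriorAlgebra

variable {K : Type*} [Field K] {M : Type*} [AddCommGroup M] [Module K M]

theorem ι_mul_ι_swap (v w : M) : ι K v * ι K w = -(ι K w * ι K v) :=
  eq_neg_of_add_eq_zero_left (ι_add_mul_swap v w)

/-- Moving a generator past two others changes the sign twice. -/
theorem ι_mul_ι_mem_center (v w : M) :
    ι K v * ι K w ∈ Subalgebra.center K (ExteriorAlgebra K M) := by
  refine Subalgebra.mem_center_iff.2 fun x => ?_
  induction x using ExteriorAlgebra.induction with
  | algebraMap r => exact Algebra.commutes r _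
  | ι u =>
    rw [mul_assoc, ι_mul_ι_swap w u, mul_neg, ← mul_assoc, ← mul_assoc, ι_mul_ι_swap v u, neg_mul,
      neg_neg]
  | mul a b ha hb => rw [mul_assoc, hb, ← mul_assoc, ha, mul_assoc]
  | add a b ha hb => rw [add_mul, mul_add, ha, hb]

variable (K M) in
/-- The span of the products of two generators with arbitrary elements. -/
def degreeTwoIdeal : Submodule K (ExteriorAlgebra K M) :=
  Submodule.span K {z | ∃ v w : M, ∃ e, ι K v * ι K w * e = z}

theorem mul_mem_degreeTwoIdeal {z : ExteriorAlgebra K M} (hz : z ∈ degreeTwoIdeal K M)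
    (b : ExteriorAlgebra K M) : z * b ∈ degreeTwoIdeal K M := by
  induction hz using Submodule.span_induction with
  | mem _ h =>
    obtain ⟨v, w, e, rfl⟩ := h
    exact Submodule.subset_span ⟨v, w, e * b, by simp only [mul_assoc]⟩
  | zero => simp
  | add x y _ _ hx hy => rw [add_mul]; exact add_mem hx hy
  | smul c x _ hx => rw [smul_mul_assoc]; exact Submodule.smul_mem _ _ hx

theorem mem_degreeTwoIdeal_mul {z : ExteriorAlgebra K M} (hz : z ∈ degreeTwoIdeal K M)
    (b : ExteriorAlgebra K M) : b * z ∈ degreeTwoIdeal K M := by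
  induction hz using Submodule.span_induction with
  | mem _ h =>
    obtain ⟨v, w, e, rfl⟩ := h
    refine Submodule.subset_span ⟨v, w, b * e, ?_⟩
    rw [← mul_assoc b, Subalgebra.mem_center_iff.1 (ι_mul_ι_mem_center v w) b, mul_assoc,
      mul_assoc, mul_assoc]
  | zero => simp
  | add x y _ _ hx hy => rw [mul_add]; exact add_mem hx hy
  | smul c x _ hx => rw [mul_smul_comm]; exact Submodule.smul_mem _ _ hx

/-- The bracket is a derivation in each argument and the ideal is two-sided, so generators suffice;
there the commutator is twice a product of two generators. -/
theorem lie_mem_degreeTwoIdeal (x y : ExteriorAlgebra K M) : ⁅x, y⁆ ∈ degreeTwoIdeal K M := by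
  have comm : ∀ {x y : ExteriorAlgebra K M}, ⁅x, y⁆ ∈ degreeTwoIdeal K M →
      ⁅y, x⁆ ∈ degreeTwoIdeal K M := by
    intro x y h
    rw [show ⁅y, x⁆ = -⁅x, y⁆ by simp [Ring.lie_def]]
    exact neg_mem h
  have ind : ∀ y : ExteriorAlgebra K M, (∀ v : M, ⁅ι K v, y⁆ ∈ degreeTwoIdeal K M) →
      ∀ x : ExteriorAlgebra K M, ⁅x, y⁆ ∈ degreeTwoIdeal K M := by
    intro y hy x
    induction x using ExteriorAlgebra.induction with
    | algebraMap r => simp [Ring.lie_def, Algebra.commutes r y]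
    | ι v => exact hy v
    | mul a b ha hb =>
      rw [show ⁅a * b, y⁆ = a * ⁅b, y⁆ + ⁅a, y⁆ * b by simp only [Ring.lie_def]; noncomm_ring]
      exact add_mem (mem_degreeTwoIdeal_mul hb a) (mul_mem_degreeTwoIdeal ha b)
    | add a b ha hb =>
      rw [show ⁅a + b, y⁆ = ⁅a, y⁆ + ⁅b, y⁆ by simp only [Ring.lie_def]; noncomm_ring]
      exact add_mem ha hb
  refine ind y (fun (v : M) => comm (ind (ι K v) (fun (w : M) => ?_) y)) x
  rw [Ring.lie_def, ι_mul_ι_swap v w, sub_neg_eq_add]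
  have : ι K w * ι K v ∈ degreeTwoIdeal K M := Submodule.subset_span ⟨w, v, 1, mul_one _⟩
  exact add_mem this this

theorem ι_mul_ι_mul_ι_mul_ι_eq_zero [FiniteDimensional K M] (hM : Module.finrank K M < 4)
    (a b c d : M) : ι K a * ι K b * (ι K c * ι K d) = 0 := by
  have h : ιMulti K 4 ![a, b, c, d] = 0 := by
    refine AlternatingMap.map_linearDependent _ _ fun hli => ?_
    have := hli.fintype_card_le_finrank
    simp at this
    omega
  simpa [ιMulti_apply, mul_assoc] using h

/-- For `z = v w e` the central factor `v w` gives `[z, b] = v w [e, b]`. As `[e, b]` lies in the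
degree-two ideal, this is a sum of multiples of products of four generators. -/
theorem commute_of_mem_degreeTwoIdeal [FiniteDimensional K M] (hM : Module.finrank K M < 4)
    {z : ExteriorAlgebra K M} (hz : z ∈ degreeTwoIdeal K M) (b : ExteriorAlgebra K M) :
    Commute z b := by
  induction hz using Submodule.span_induction with
  | mem _ h =>
    obtain ⟨v, w, e, rfl⟩ := h
    have key : ∀ t ∈ degreeTwoIdeal K M, ι K v * ι K w * t = 0 := by
      intro t ht
      induction ht using Submodule.span_induction with
      | mem _ h =>
        obtain ⟨v', w', e', rfl⟩ := h
        rw [← mul_assoc, ι_mul_ι_mul_ι_mul_ι_eq_zero hM, zero_mul]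
      | zero => simp
      | add x y _ _ hx hy => rw [mul_add, hx, hy, add_zero]
      | smul c x _ hx => rw [mul_smul_comm, hx, smul_zero]
    have h1 := key _ (lie_mem_degreeTwoIdeal e b)
    rw [Ring.lie_def, mul_sub, sub_eq_zero] at h1
    rw [Commute, SemiconjBy, mul_assoc, h1, ← mul_assoc, ← mul_assoc,
      Subalgebra.mem_center_iff.1 (ι_mul_ι_mem_center v w) b]
  | zero => exact Commute.zero_left b
  | add x y _ _ hx hy => exact hx.add_left hy
  | smul c x _ hx => exact hx.smul_left c

/-- Every element of a Grassmann algebra is a central element plus a sum of products of generators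
with central elements. -/
theorem mem_center_sup_span (x : ExteriorAlgebra K M) :
    x ∈ Subalgebra.toSubmodule (Subalgebra.center K (ExteriorAlgebra K M)) ⊔
      Submodule.span K {z | ∃ v : M, ∃ c ∈ Subalgebra.center K (ExteriorAlgebra K M),
        ι K v * c = z} := by
  set C := Subalgebra.center K (ExteriorAlgebra K M) with hC
  set S : Set (ExteriorAlgebra K M) := {z | ∃ v : M, ∃ c ∈ C, ι K v * c = z} with hS
  have hcomm : ∀ c ∈ C, ∀ b, b * c = c * b := fun c hc => Subalgebra.mem_center_iff.1 hc
  have hspan : ∀ T : Submodule K (ExteriorAlgebra K M),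
      (∀ c ∈ C, c ∈ T) → (∀ v, ∀ c ∈ C, ι K v * c ∈ T) →
      Subalgebra.toSubmodule C ⊔ Submodule.span K S ≤ T := by
    intro T h1 h2
    refine sup_le h1 (Submodule.span_le.2 ?_)
    rintro _ ⟨v, c, hc, rfl⟩
    exact h2 v c hc
  set T := Subalgebra.toSubmodule C ⊔ Submodule.span K S
  have hT1 : ∀ c ∈ C, c ∈ T := fun c hc => Submodule.mem_sup_left hc
  have hT2 : ∀ v, ∀ c ∈ C, ι K v * c ∈ T := fun v c hc =>
    Submodule.mem_sup_right (Submodule.subset_span ⟨v, c, hc, rfl⟩)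
  induction x using ExteriorAlgebra.induction with
  | algebraMap r => exact hT1 _ (C.algebraMap_mem r)
  | ι v => simpa using hT2 v 1 C.one_mem
  | add a b ha hb => exact add_mem ha hb
  | mul a b ha hb =>
    have hc : ∀ c ∈ C, b * c ∈ T := fun c hc =>
      hspan (T.comap (LinearMap.mulRight K c)) (fun c' hc' => hT1 _ (C.mul_mem hc' hc))
        (fun v c' hc' => by
          simpa [mul_assoc] using hT2 v _ (C.mul_mem hc' hc)) hb
    -- Left multiplication by a generator interchanges the two summands, as products of two
    -- generators are central.
    have hι : ∀ v, ι K v * b ∈ T := fun v =>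
      hspan (T.comap (LinearMap.mulLeft K (ι K v))) (fun c' hc' => hT2 _ _ hc')
        (fun w c' hc' => by
          simpa [mul_assoc] using hT1 _ (C.mul_mem (ι_mul_ι_mem_center v w) hc')) hb
    have hTc : ∀ t ∈ T, ∀ c ∈ C, t * c ∈ T := fun t ht c hc =>
      hspan (T.comap (LinearMap.mulRight K c)) (fun c' hc' => hT1 _ (C.mul_mem hc' hc))
        (fun v c' hc' => by
          simpa [mul_assoc] using hT2 v _ (C.mul_mem hc' hc)) ht
    refine hspan (T.comap (LinearMap.mulRight K b)) (fun c h => ?_) (fun v c h => ?_) ha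
    · simpa [← hcomm c h b] using hc c h
    · simpa [mul_assoc, ← hcomm c h b] using hTc _ (hι v) c h

/-- Central parts drop out of the bracket, leaving products of two generators with central
coefficients. -/
theorem lie_mem_center (x y : ExteriorAlgebra K M) :
    ⁅x, y⁆ ∈ Subalgebra.center K (ExteriorAlgebra K M) := by
  have hy := mem_center_sup_span y
  have hx := mem_center_sup_span x
  set C := Subalgebra.center K (ExteriorAlgebra K M) with hC
  have hcomm : ∀ c ∈ C, ∀ b, b * c = c * b := fun c hc => Subalgebra.mem_center_iff.1 hc
  obtain ⟨c, hc, s, hs, rfl⟩ := Submodule.mem_sup.1 hx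
  obtain ⟨c', hc', s', hs', rfl⟩ := Submodule.mem_sup.1 hy
  rw [show ⁅c + s, c' + s'⁆ = ⁅s, s'⁆ by
    rw [Ring.lie_def, Ring.lie_def, add_mul, mul_add, mul_add, add_mul, mul_add, mul_add,
      hcomm c hc c', hcomm c hc s', hcomm c' hc' s]
    abel]
  clear hx hy
  induction hs, hs' using Submodule.span_induction₂ with
  | mem_mem x y hx hy =>
    obtain ⟨v, c, hc, rfl⟩ := hx
    obtain ⟨w, c', hc', rfl⟩ := hy
    have e : ∀ v w : M, ∀ c ∈ C, ∀ c' : ExteriorAlgebra K M,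
        ι K v * c * (ι K w * c') = ι K v * ι K w * (c * c') := by
      intro v w c hc c'
      rw [mul_assoc, ← mul_assoc c, ← hcomm c hc, mul_assoc, mul_assoc]
    rw [Ring.lie_def, e v w c hc, e w v c' hc']
    exact sub_mem (mul_mem (ι_mul_ι_mem_center v w) (mul_mem hc hc'))
      (mul_mem (ι_mul_ι_mem_center w v) (mul_mem hc' hc))
  | zero_left y hy => simp [Ring.lie_def]
  | zero_right y hy => simp [Ring.lie_def]
  | add_left x y z _ _ _ hx hy =>
    rw [show ⁅x + y, z⁆ = ⁅x, z⁆ + ⁅y, z⁆ by simp only [Ring.lie_def]; noncomm_ring]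
    exact add_mem hx hy
  | add_right x y z _ _ _ hx hy =>
    rw [show ⁅x, y + z⁆ = ⁅x, y⁆ + ⁅x, z⁆ by simp only [Ring.lie_def]; noncomm_ring]
    exact add_mem hx hy
  | smul_left r x y _ _ h =>
    rw [show ⁅r • x, y⁆ = r • ⁅x, y⁆ by simp [Ring.lie_def, smul_sub]]
    exact C.smul_mem h r
  | smul_right r x y _ _ h =>
    rw [show ⁅x, r • y⁆ = r • ⁅x, y⁆ by simp [Ring.lie_def, smul_sub]]
    exact C.smul_mem h r

variable (K M) in
theorem lieSeries_exteriorAlgebra : lieSeries K (ExteriorAlgebra K M) 2 = ⊥ := by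
  refine eq_bot_iff.2 (lieSeries_succ_le fun u hu a => ?_)
  have hle : lieSeries K (ExteriorAlgebra K M) 1 ≤
      Subalgebra.toSubmodule (Subalgebra.center K (ExteriorAlgebra K M)) :=
    lieSeries_succ_le fun x _ y => lie_mem_center x y
  have h1 : u ∈ Subalgebra.center K (ExteriorAlgebra K M) := hle hu
  rw [Submodule.mem_bot, Ring.lie_def, Subalgebra.mem_center_iff.1 h1 a, sub_self]

end Grassmann

/-! ### Induction on the number of tensor factors -/

section Tensor

variable {K : Type*} [Field K]

/-- The embedding of `E ⊗ B^{⊗ k}` into `E ⊗ B^{⊗ (k + 1)}` with the first new factor `1`. -/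
noncomputable def tensorPowSucc (K : Type*) [Field K] (E B : Type*) [Ring E] [Algebra K E] [Ring B] [Algebra K B]
    (k : ℕ) : (E ⊗[K] (⨂[K] _ : Fin k, B)) →ₐ[K] (E ⊗[K] (⨂[K] _ : Fin (k + 1), B)) :=
  Algebra.TensorProduct.map (AlgHom.id K E)
    (PiTensorProduct.liftAlgHom ((PiTensorProduct.tprod K (s := fun _ : Fin (k + 1) => B)).curryLeft 1)
      (by
        rw [MultilinearMap.curryLeft_apply, PiTensorProduct.one_def]
        congr 1
        ext i
        refine Fin.cases rfl (fun _ => rfl) i)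
      (fun x y => by
        simp only [MultilinearMap.curryLeft_apply, PiTensorProduct.tprod_mul_tprod]
        congr 1
        ext i
        refine Fin.cases (by simp) (fun _ => by simp) i))

theorem tensorPowSucc_tmul_tprod (E B : Type*) [Ring E] [Algebra K E] [Ring B] [Algebra K B]
    (k : ℕ) (x : E) (F : Fin k → B) :
    tensorPowSucc K E B k (x ⊗ₜ PiTensorProduct.tprod K F) =
      x ⊗ₜ PiTensorProduct.tprod K (Fin.cons 1 F : Fin (k + 1) → B) := by
  simp [tensorPowSucc, PiTensorProduct.liftAlgHom]

theorem span_tmul_tprod (E B : Type*) [Ring E] [Algebra K E] [Ring B] [Algebra K B] (k : ℕ) :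
    Submodule.span K {w : E ⊗[K] (⨂[K] _ : Fin k, B) |
      ∃ x, ∃ F : Fin k → B, x ⊗ₜ PiTensorProduct.tprod K F = w} = ⊤ := by
  refine eq_top_iff.2 ?_
  rw [← TensorProduct.span_tmul_eq_top, Submodule.span_le]
  rintro _ ⟨x, y, rfl⟩
  have hy : y ∈ Submodule.span K (Set.range (PiTensorProduct.tprod K (s := fun _ : Fin k => B))) := by
    rw [PiTensorProduct.span_tprod_eq_top]; trivial
  induction hy using Submodule.span_induction with
  | mem _ h => obtain ⟨F, rfl⟩ := h; exact Submodule.subset_span ⟨x, F, rfl⟩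
  | zero => simp
  | add a b _ _ ha hb => rw [TensorProduct.tmul_add]; exact add_mem ha hb
  | smul c a _ ha => rw [TensorProduct.tmul_smul]; exact Submodule.smul_mem _ _ ha

/-- The first of the `k + 1` factors is split off: its image commutes with that of `E ⊗ B^{⊗ k}`,
and products of the two images span. Each such factor costs two. -/
theorem lieSeries_tensorPow_eq_bot (h2 : (2 : K) ≠ 0) (h3 : (3 : K) ≠ 0) {E B : Type*} [Ring E]
    [Algebra K E] [Ring B] [Algebra K B] (Z : Submodule K B) (hZ : ∀ b b' : B, ⁅b, b'⁆ ∈ Z)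
    (hmul : ∀ z ∈ Z, ∀ b, z * b ∈ Z) (hcomm : ∀ z ∈ Z, ∀ b, Commute z b)
    {n : ℕ} (h : lieSeries K E n = ⊥) (k : ℕ) :
    lieSeries K (E ⊗[K] (⨂[K] _ : Fin k, B)) (2 * k + n) = ⊥ := by
  induction k with
  | zero =>
    rw [mul_zero, zero_add]
    refine lieSeries_eq_bot_of_surjective (f := Algebra.TensorProduct.includeLeft) ?_ h
    let φ : E →ₐ[K] E ⊗[K] (⨂[K] _ : Fin 0, B) := Algebra.TensorProduct.includeLeft
    suffices h : LinearMap.range φ.toLinearMap = ⊤ from LinearMap.range_eq_top.1 h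
    refine eq_top_iff.2 ?_
    rw [← span_tmul_tprod, Submodule.span_le]
    rintro _ ⟨x, F, rfl⟩
    exact ⟨x, congrArg (fun G => x ⊗ₜ[K] PiTensorProduct.tprod K G) (Subsingleton.elim _ F)⟩
  | succ k ih =>
    rw [show 2 * (k + 1) + n = 2 * k + n + 2 by ring]
    let g : B →ₐ[K] (E ⊗[K] (⨂[K] _ : Fin (k + 1), B)) :=
      Algebra.TensorProduct.includeRight.comp
        (PiTensorProduct.singleAlgHom (R := K) (A := fun _ : Fin (k + 1) => B) 0)
    have hg : ∀ b, g b = 1 ⊗ₜ PiTensorProduct.tprod K (Fin.cons b 1 : Fin (k + 1) → B) := by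
      intro b
      change _ ⊗ₜ PiTensorProduct.tprod K (Pi.mulSingle (M := fun _ : Fin (k + 1) => B) 0 b) = _
      congr 2
      ext i
      refine Fin.cases (by simp) (fun i => by simp) i
    have hprod : ∀ x (F : Fin k → B) b,
        tensorPowSucc K E B k (x ⊗ₜ PiTensorProduct.tprod K F) * g b =
          x ⊗ₜ PiTensorProduct.tprod K (Fin.cons b F : Fin (k + 1) → B) := by
      intro x F b
      rw [tensorPowSucc_tmul_tprod, hg, Algebra.TensorProduct.tmul_mul_tmul, mul_one,
        PiTensorProduct.tprod_mul_tprod]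
      congr 2
      ext i
      refine Fin.cases (by simp) (fun i => by simp) i
    have hprod' : ∀ x (F : Fin k → B) b,
        g b * tensorPowSucc K E B k (x ⊗ₜ PiTensorProduct.tprod K F) =
          x ⊗ₜ PiTensorProduct.tprod K (Fin.cons b F : Fin (k + 1) → B) := by
      intro x F b
      rw [tensorPowSucc_tmul_tprod, hg, Algebra.TensorProduct.tmul_mul_tmul, one_mul,
        PiTensorProduct.tprod_mul_tprod]
      congr 2
      ext i
      refine Fin.cases (by simp) (fun i => by simp) i
    refine lieSeries_eq_bot_of_span_eq_top h2 h3 (tensorPowSucc K E B k) g (fun a b => ?_) ?_ Z hZ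
      hmul hcomm ih
    · have ha : a ∈ Submodule.span K {w : E ⊗[K] (⨂[K] _ : Fin k, B) |
          ∃ x, ∃ F : Fin k → B, x ⊗ₜ PiTensorProduct.tprod K F = w} := by
        rw [span_tmul_tprod]; trivial
      induction ha using Submodule.span_induction with
      | mem _ h => obtain ⟨x, F, rfl⟩ := h; exact (hprod x F b).trans (hprod' x F b).symm
      | zero => simp
      | add a c _ _ ha hc => rw [map_add]; exact ha.add_left hc
      | smul s a _ ha => rw [map_smul]; exact ha.smul_left s
    · refine eq_top_iff.2 ?_
      rw [← span_tmul_tprod]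
      refine Submodule.span_mono ?_
      rintro _ ⟨x, F, rfl⟩
      exact ⟨x ⊗ₜ PiTensorProduct.tprod K (Fin.tail F), F 0, by rw [hprod, Fin.cons_self_tail]⟩

theorem satisfiesIdentity_iff {A : Type*} [Ring A] [Algebra K A] (n : ℕ) :
    SatisfiesIdentity K A (lieNilpotentPoly K n) ↔ ∀ a : ℕ → A, longCommutator a n = 0 := by
  have key : ∀ (a : ℕ → A) (n : ℕ),
      FreeAlgebra.lift K a (longCommutator (FreeAlgebra.ι K) n) = longCommutator a n := by
    intro a n
    cases n with
    | zero => exact map_zero _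
    | succ n =>
      induction n with
      | zero => simp [longCommutator]
      | succ n ih =>
        simp only [longCommutator, Ring.lie_def, map_sub, map_mul, ih, FreeAlgebra.lift_ι_apply]
  simp only [SatisfiesIdentity, lieNilpotentPoly, key]

theorem satisfiesIdentity_grassmannTensor (h2 : (2 : K) ≠ 0) (h3 : (3 : K) ≠ 0) {r : ℕ}
    (hr : r < 4) (k : ℕ) :
    SatisfiesIdentity K (GrassmannTensor K r k) (lieNilpotentPoly K (2 * k + 3)) := by
  rw [satisfiesIdentity_iff]
  intro a
  obtain ⟨ys, hl, h⟩ := longCommutator_eq_foldBracket a (2 * k + 2)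
  rw [h]
  -- Index `2 * k + 2` corresponds to commutators of length `2 * k + 3`.
  have hb : lieSeries K (GrassmannTensor K r k) (2 * k + 2) = ⊥ :=
    lieSeries_tensorPow_eq_bot h2 h3 (degreeTwoIdeal K (Fin r → K)) lie_mem_degreeTwoIdeal
      (fun _ hz => mul_mem_degreeTwoIdeal hz)
      (fun _ hz => commute_of_mem_degreeTwoIdeal (by simpa using hr) hz)
      (lieSeries_exteriorAlgebra K (ℕ →₀ K)) k
  exact eq_zero_of_lieSeries_eq_bot hb le_rfl (hl ▸ foldBracket_mem_lieSeries (a 0) ys)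

end Tensor
end GrassmannPI

namespace GrassmannPI

/-! ### A nonvanishing commutator of length `2k + 2` -/

section LowerBound

open ExteriorAlgebra

variable {K : Type*} [Field K]

/-- The functional is the determinant of the coordinates given by `L`, extended by zero to the other
degrees; on `v` it is the determinant of the identity matrix. -/
theorem exists_dual_ιMulti_eq_one {M : Type*} [AddCommGroup M] [Module K M] {n : ℕ}
    (v : Fin n → M) (L : M →ₗ[K] Fin n → K) (hL : ∀ i, L (v i) = Pi.single i 1) :
    ∃ ψ : ExteriorAlgebra K M →ₗ[K] K, ψ (ιMulti K n v) = 1 := by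
  refine ⟨liftAlternating (Pi.single n (Matrix.detRowAlternating.compLinearMap L)), ?_⟩
  rw [liftAlternating_apply_ιMulti, Pi.single_eq_same, AlternatingMap.compLinearMap_apply]
  have : (fun i => L (v i)) = (1 : Matrix (Fin n) (Fin n) K) := by
    ext i j
    rw [hL, Matrix.one_apply, Pi.single_apply]
    simp only [eq_comm]
  exact (congrArg Matrix.det this).trans Matrix.det_one

variable (K) in
/-- The `i`-th generator of the infinite-dimensional Grassmann algebra. -/
noncomputable def gen (i : ℕ) : GrassmannInf K := ι K (Finsupp.single i 1)

variable (K) in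
/-- The product of the first `m` generators. -/
noncomputable def genProd : ℕ → GrassmannInf K
  | 0 => 1
  | m + 1 => genProd m * gen K m

theorem genProd_eq_ιMulti (m : ℕ) :
    genProd K m = ιMulti K m (fun i : Fin m => Finsupp.single (i : ℕ) (1 : K)) := by
  induction m with
  | zero => simp [genProd]
  | succ m ih =>
    rw [genProd, ih, ιMulti_apply, ιMulti_apply, List.ofFn_succ_last, List.prod_append]
    simp [gen]

theorem exists_dual_genProd_eq_one (m : ℕ) :
    ∃ ψ : GrassmannInf K →ₗ[K] K, ψ (genProd K m) = 1 := by
  rw [genProd_eq_ιMulti]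
  refine exists_dual_ιMulti_eq_one _ (LinearMap.pi fun i => Finsupp.lapply (i : ℕ)) fun i => ?_
  ext j
  simp [Finsupp.single_apply, Pi.single_apply, Fin.ext_iff, eq_comm]

theorem gen_mul_genProd (n m : ℕ) : gen K n * genProd K m = (-1) ^ m * (genProd K m * gen K n) := by
  induction m with
  | zero => simp [genProd]
  | succ m ih =>
    rw [genProd, ← mul_assoc, ih, mul_assoc, mul_assoc, gen, gen, ι_mul_ι_swap, pow_succ]
    noncomm_ring

variable {B : Type*} [Ring B] [Algebra K B]

/-- The tensor components of the commutator of the first `2i + 1` test elements. -/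
def stateVec (p q : B) (k i : ℕ) (t : Fin k) : B :=
  if (t : ℕ) < i then p * q else if (t : ℕ) = i then p else 1

/-- The tensor components of the `2i`-th test element. -/
def inputVec (p q : B) (k i : ℕ) (t : Fin k) : B :=
  if (t : ℕ) + 1 = i then q else if (t : ℕ) = i then p else 1

theorem stateVec_mul_inputVec (p q : B) (k i : ℕ) :
    stateVec p q k i * inputVec p q k (i + 1) = stateVec p q k (i + 1) := by
  ext t
  simp only [Pi.mul_apply, stateVec, inputVec]
  rcases lt_trichotomy (t : ℕ) i with h | h | h
  · simp [h, h.ne, Nat.lt_succ_of_lt h, (Nat.lt_succ_of_lt h).ne]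
  · simp [h]
  · simp [h.ne', not_lt.2 h.le, not_lt.2 (Nat.succ_le_of_lt h)]

/-- Only slot `i` multiplies `q` by `p` in the wrong order. Writing the result as an update lets
multilinearity extract the single sign. -/
theorem inputVec_mul_stateVec {p q : B} (hpq : q * p = -(p * q)) {k i : ℕ} (hi : i < k) :
    inputVec p q k (i + 1) * stateVec p q k i =
      Function.update (stateVec p q k (i + 1)) ⟨i, hi⟩ (-(p * q)) := by
  ext t
  rw [Function.update_apply]
  simp only [Pi.mul_apply, stateVec, inputVec, Fin.ext_iff]
  rcases lt_trichotomy (t : ℕ) i with h | h | h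
  · simp [h, h.ne, Nat.lt_succ_of_lt h, (Nat.lt_succ_of_lt h).ne]
  · simp [h, hpq]
  · simp [h.ne', not_lt.2 h.le, not_lt.2 (Nat.succ_le_of_lt h)]

theorem tprod_inputVec_mul_stateVec {p q : B} (hpq : q * p = -(p * q)) {k i : ℕ} (hi : i < k) :
    PiTensorProduct.tprod K (inputVec p q k (i + 1) * stateVec p q k i) =
      -PiTensorProduct.tprod K (stateVec p q k (i + 1)) := by
  rw [inputVec_mul_stateVec hpq hi, MultilinearMap.map_update_neg]
  congr 2
  refine Function.update_eq_self_iff.2 ?_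
  simp [stateVec]

theorem lie_smul_of_mul_eq {A : Type*} [Ring A] [Algebra K A] {x y w : A} (hxy : x * y = w)
    (hyx : y * x = -w) (m : ℕ) : ⁅(2 : K) ^ m • x, y⁆ = (2 : K) ^ (m + 1) • w := by
  rw [Ring.lie_def, smul_mul_assoc, mul_smul_comm, ← smul_sub, hxy, hyx, sub_neg_eq_add,
    ← two_smul K, smul_smul, ← pow_succ]

/-- Test elements whose long commutator of length `2k + 2` does not vanish. -/
noncomputable def testElement (K : Type*) [Field K] {B : Type*} [Ring B] [Algebra K B] (p q : B)
    (k n : ℕ) : GrassmannInf K ⊗[K] (⨂[K] _ : Fin k, B) :=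
  gen K n ⊗ₜ PiTensorProduct.tprod K (if Even n then inputVec p q k (n / 2) else 1)

/-- The source of the anticommutation alternates. After `2i + 1` entries the `E`-part has odd
degree, so the next generator anticommutes with it while the other tensor slots are `1`. After `2i +
2` entries the `E`-part has even degree and commutes, and the sign comes from `p` meeting `q` in
slot `i`. Each bracket therefore doubles the product. -/
theorem longCommutator_testElement {p q : B} (hpq : q * p = -(p * q)) {k i : ℕ} (hi : i ≤ k) :
    longCommutator (testElement K p q k) (2 * i + 1) =
        (2 : K) ^ (2 * i) • (genProd K (2 * i + 1) ⊗ₜ PiTensorProduct.tprod K (stateVec p q k i)) ∧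
      longCommutator (testElement K p q k) (2 * i + 2) =
        (2 : K) ^ (2 * i + 1) •
          (genProd K (2 * i + 2) ⊗ₜ PiTensorProduct.tprod K (stateVec p q k i)) := by
  have odd_step : ∀ i, longCommutator (testElement K p q k) (2 * i + 1) =
        (2 : K) ^ (2 * i) • (genProd K (2 * i + 1) ⊗ₜ PiTensorProduct.tprod K (stateVec p q k i)) →
      longCommutator (testElement K p q k) (2 * i + 2) =
        (2 : K) ^ (2 * i + 1) •
          (genProd K (2 * i + 2) ⊗ₜ PiTensorProduct.tprod K (stateVec p q k i)) := by
    intro i h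
    have hx : testElement K p q k (2 * i + 1) = gen K (2 * i + 1) ⊗ₜ 1 := by
      rw [testElement, if_neg (by simp), PiTensorProduct.one_def]
    rw [longCommutator, h, hx]
    refine lie_smul_of_mul_eq ?_ ?_ _
    · rw [Algebra.TensorProduct.tmul_mul_tmul, mul_one]
      rfl
    · rw [Algebra.TensorProduct.tmul_mul_tmul, one_mul, gen_mul_genProd, Odd.neg_one_pow ⟨i, rfl⟩,
        neg_one_mul, TensorProduct.neg_tmul]
      rfl
  suffices h : ∀ i ≤ k, longCommutator (testElement K p q k) (2 * i + 1) =
      (2 : K) ^ (2 * i) • (genProd K (2 * i + 1) ⊗ₜ PiTensorProduct.tprod K (stateVec p q k i)) from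
    ⟨h i hi, odd_step i (h i hi)⟩
  clear hi i
  intro i hi
  induction i with
  | zero =>
    simp only [longCommutator, testElement, genProd, mul_zero, pow_zero, one_smul, one_mul,
      Nat.zero_div]
    rw [if_pos Even.zero]
    rfl
  | succ i ih =>
    have h := odd_step i (ih (by omega))
    have hx : testElement K p q k (2 * i + 2) =
        gen K (2 * i + 2) ⊗ₜ PiTensorProduct.tprod K (inputVec p q k (i + 1)) := by
      rw [testElement, if_pos ⟨i + 1, by ring⟩, show (2 * i + 2) / 2 = i + 1 by omega]
    rw [show 2 * (i + 1) + 1 = 2 * i + 1 + 2 by ring, longCommutator, h, hx]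
    refine lie_smul_of_mul_eq ?_ ?_ _
    · rw [Algebra.TensorProduct.tmul_mul_tmul, PiTensorProduct.tprod_mul_tprod,
        stateVec_mul_inputVec]
      rfl
    · rw [Algebra.TensorProduct.tmul_mul_tmul, PiTensorProduct.tprod_mul_tprod, gen_mul_genProd,
        Even.neg_one_pow ⟨i + 1, by ring⟩, one_mul, tprod_inputVec_mul_stateVec hpq (by omega),
        TensorProduct.tmul_neg]
      rfl

theorem not_satisfiesIdentity_of_anticommuting (h2 : (2 : K) ≠ 0) {p q : B}
    (hpq : q * p = -(p * q)) (φ : B →ₗ[K] K) (hφ : φ (p * q) = 1) (k : ℕ) :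
    ¬ SatisfiesIdentity K (GrassmannInf K ⊗[K] (⨂[K] _ : Fin k, B))
      (lieNilpotentPoly K (2 * k + 2)) := by
  rw [satisfiesIdentity_iff]
  intro h
  obtain ⟨ψ, hψ⟩ := exists_dual_genProd_eq_one (K := K) (2 * k + 2)
  -- At `i = k` every slot of the state is `p * q`, so the product of the slotwise values of `φ` is
  -- `1`.
  let Φ : (⨂[K] _ : Fin k, B) →ₗ[K] K :=
    PiTensorProduct.lift ((MultilinearMap.mkPiAlgebra K (Fin k) K).compLinearMap fun _ => φ)
  have hΦ : Φ (PiTensorProduct.tprod K (stateVec p q k k)) = 1 := by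
    simp [Φ, stateVec, hφ]
  have h1 := h (testElement K p q k)
  rw [(longCommutator_testElement hpq le_rfl).2] at h1
  have h3 := congrArg (LinearMap.mul' K K ∘ₗ TensorProduct.map ψ Φ) h1
  simp [hψ, hΦ, h2] at h3

theorem not_satisfiesIdentity_grassmannTensor (h2 : (2 : K) ≠ 0) (r k : ℕ) :
    ¬ SatisfiesIdentity K (GrassmannTensor K (r + 2) k) (lieNilpotentPoly K (2 * k + 2)) := by
  let v : Fin 2 → Fin (r + 2) → K := ![Pi.single 0 1, Pi.single 1 1]
  obtain ⟨φ, hφ⟩ := exists_dual_ιMulti_eq_one v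
    (LinearMap.pi fun j : Fin 2 => LinearMap.proj (![0, 1] j : Fin (r + 2))) (fun i => by
      ext j
      fin_cases i <;> fin_cases j <;> simp [v])
  refine not_satisfiesIdentity_of_anticommuting h2 (ι_mul_ι_swap (v 1) (v 0)) φ ?_ k
  simpa [ιMulti_apply, Matrix.vecTail] using hφ

theorem longCommutator_eq_zero_of_le {A : Type*} [Ring A] {a : ℕ → A} {m n : ℕ} (hm : 1 ≤ m)
    (hmn : m ≤ n) (h : longCommutator a m = 0) : longCommutator a n = 0 := by
  induction n, hmn using Nat.le_induction with
  | base => exact h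
  | succ n hn ih =>
    obtain ⟨n, rfl⟩ : ∃ n', n = n' + 1 := ⟨n - 1, by omega⟩
    rw [longCommutator, ih, Ring.lie_def, zero_mul, mul_zero, sub_zero]

end LowerBound

end GrassmannPI

theorem corollary2p10 (K : Type*) [Field K] (hK2 : ringChar K ≠ 2) (k : ℕ) :
    (ringChar K ≠ 3 →
      GrassmannPI.SatisfiesIdentity K (GrassmannPI.GrassmannTensor K 2 k)
          (GrassmannPI.lieNilpotentPoly K (2 * k + 3)) ∧
        GrassmannPI.SatisfiesIdentity K (GrassmannPI.GrassmannTensor K 3 k)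
          (GrassmannPI.lieNilpotentPoly K (2 * k + 3))) ∧
    (¬ GrassmannPI.SatisfiesIdentity K (GrassmannPI.GrassmannTensor K 2 k)
          (GrassmannPI.lieNilpotentPoly K (2 * k + 2)) ∧
      ¬ GrassmannPI.SatisfiesIdentity K (GrassmannPI.GrassmannTensor K 3 k)
          (GrassmannPI.lieNilpotentPoly K (2 * k + 2))) ∧
    (ringChar K ≠ 3 →
      IsLeast {q : ℕ | 1 ≤ q ∧ GrassmannPI.SatisfiesIdentity K (GrassmannPI.GrassmannTensor K 2 k)
          (GrassmannPI.lieNilpotentPoly K q)} (2 * k + 3)) := by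
  have h2 : (2 : K) ≠ 0 := Ring.two_ne_zero hK2
  have h3 : ringChar K ≠ 3 → (3 : K) ≠ 0 := fun h h0 =>
    h (CharP.ringChar_of_prime_eq_zero Nat.prime_three (by exact_mod_cast h0))
  have hlow := GrassmannPI.not_satisfiesIdentity_grassmannTensor h2 0 k
  refine ⟨fun h => ⟨GrassmannPI.satisfiesIdentity_grassmannTensor h2 (h3 h) (by norm_num) k,
      GrassmannPI.satisfiesIdentity_grassmannTensor h2 (h3 h) (by norm_num) k⟩,
    ⟨hlow, GrassmannPI.not_satisfiesIdentity_grassmannTensor h2 1 k⟩, fun h =>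
    ⟨⟨by omega, GrassmannPI.satisfiesIdentity_grassmannTensor h2 (h3 h) (by norm_num) k⟩, ?_⟩⟩
  rintro q ⟨hq, hs⟩
  by_contra! hlt
  -- An identity of length `q ≤ 2k + 2` would propagate up to length `2k + 2`; `1 ≤ q` excludes the
  -- conventional zero at length `0`.
  refine hlow ((GrassmannPI.satisfiesIdentity_iff _).2 fun a => ?_)
  exact GrassmannPI.longCommutator_eq_zero_of_le hq (by omega)
    ((GrassmannPI.satisfiesIdentity_iff _).1 hs a)
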